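/- Let $r>1$ and $\mu\in\mathbb R$. For a $2\pi$-periodic function $f\in L^\infty(\mathbb R)$ put $\hat f(k)=\frac1{2\pi}\int_{-\pi}^{\pi}f(x)e^{-ikx}\,dx$ and $L_rf(x)=\sum_{k\neq0}|k|^{-r}\hat f(k)e^{ikx}$. Let $\phi\in L^\infty(\mathbb R)$ be real-valued and $2\pi$-periodic, with $\phi\le\mu$ almost everywhere, and let $\phi$ solve the steady equation $$\tfrac12(\mu-\phi)^2=\tfrac12\mu^2-L_r\phi+\tfrac12\widehat{\phi^2}(0)$$ almost everywhere. Then $\phi$ has a continuous $2\pi$-periodic representative, which takes the value $\phi(x)$ at every point $x$ where $\phi(x)\le\mu$ and the equation holds; denote this representative again by $\phi$. Moreover: (i) if $\phi<\mu$ uniformly, that is, $\phi\le\mu-\delta$ almost everywhere for some $\delta>0$, then $\phi\in C^\infty(\mathbb R)$; (ii) $\phi$ is $C^\infty$ on every open set $U\subset\mathbb R$ with $\phi<\mu$ on $U$. -/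

import Mathlib

open Real MeasureTheory
open scoped ContDiff

noncomputable section

/-- The `k`-th Fourier coefficient `(1 / 2π) ∫_{-π}^{π} f(x) e^{-ikx} dx` of a real function. -/
def torusFourierCoeff (f : ℝ → ℝ) (k : ℤ) : ℂ :=
  fourierCoeffOn (neg_lt_self Real.pi_pos) (fun x => (f x : ℂ)) k

/-- The symbol `m_r(k) = |k|^{-r}` for `k ≠ 0`, and `m_r(0) = 0`. -/
def homogeneousSymbol (r : ℝ) (k : ℤ) : ℝ :=
  if k = 0 then 0 else |(k : ℝ)| ^ (-r)

/-- The Fourier multiplier `L_r f(x) = ∑_{k ≠ 0} |k|^{-r} f̂(k) e^{ikx}`. For `r > 1` and `f`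
integrable over a period the series converges absolutely and uniformly in `x`. -/
def fourierMultiplier (r : ℝ) (f : ℝ → ℝ) (x : ℝ) : ℂ :=
  ∑' k : ℤ, (homogeneousSymbol r k : ℂ) * torusFourierCoeff f k *
    Complex.exp (Complex.I * (k : ℂ) * (x : ℂ))

/-- The steady equation `½ (μ - φ)² = ½ μ² - L_r φ + ½ (φ²)^(0)` at the point `x`. -/
def SteadyEquationAt (r μ : ℝ) (φ : ℝ → ℝ) (x : ℝ) : Prop :=
  (1 / 2 : ℂ) * ((μ : ℂ) - (φ x : ℂ)) ^ 2 =
    (1 / 2 : ℂ) * (μ : ℂ) ^ 2 - fourierMultiplier r φ x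
      + (1 / 2 : ℂ) * torusFourierCoeff (fun y => φ y ^ 2) 0

/-- A bounded (`L^∞`) `2π`-periodic solution of the steady equation; as for any element
of `L^∞`, the equation is required almost everywhere. -/
structure IsBoundedSteadySolution (r μ : ℝ) (φ : ℝ → ℝ) : Prop where
  periodic : Function.Periodic φ (2 * π)
  memLp_top : MemLp φ ⊤ volume
  equation : ∀ᵐ x, SteadyEquationAt r μ φ x

end

/-! Since `φ ≤ μ`, the equation can be solved for `φ` almost everywhere: `φ = μ - √(c - 2 L_r φ)`,
where `c` is `μ²` plus the mean of `φ²`. The series for `L_r φ` converges uniformly, so the right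
side is continuous; it is the representative `ψ`. Where `ψ < μ` the root stays off its singularity,
so `ψ` is as smooth there as `L_r ψ`. If `L_r` gains one derivative locally, induction gives `C^∞`.

For the gain, `L_r` is convolution with a kernel `K`, and `Γ(r) K(x) = B(e^{ix}) + B(e^{-ix})` with
`B` the Bose integral. `B` is holomorphic off the ray `[1, ∞)`, so `K` is smooth off `2πℤ`; bounding
`B'` on the circle gives `|K'| ≤ C |sin x|^{-θ}` with `θ < 1`, so `K'` is integrable near `0`. Cut
`K` off near `0`: the far part convolves to a smooth function, and integration by parts turns the
near part into `(ηK)'` convolved with a primitive of `ψ`, which is one degree smoother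
(`contDiffOn_kernel_integral`). -/

/-! ### The Bose integral: series, holomorphy, growth near `1` -/

/-- The Bose integral, which is `Γ(r)` times the polylogarithm of order `r`. -/
noncomputable def boseIntegral (r : ℝ) (q : ℂ) : ℂ :=
  ∫ t in Set.Ioi (0 : ℝ), ((t ^ (r - 1) : ℝ) : ℂ) * (q * (rexp (-t) : ℂ) / (1 - q * (rexp (-t) : ℂ)))

/-- The derivative of `boseIntegral r`. -/
noncomputable def boseIntegralDeriv (r : ℝ) (q : ℂ) : ℂ :=
  ∫ t in Set.Ioi (0 : ℝ), ((t ^ (r - 1) : ℝ) : ℂ) * ((rexp (-t) : ℂ) / (1 - q * (rexp (-t) : ℂ)) ^ 2)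

/-- Geometric expansion in `q e^{-t}`, integrated termwise as a Mellin transform; `r > 1` gives
summability even on `|q| = 1`. -/
theorem hasSum_boseIntegral {r : ℝ} (hr : 1 < r) {q : ℂ} (hq : ‖q‖ ≤ 1) :
    HasSum (fun n : ℕ => (Real.Gamma r : ℂ) * (q ^ (n + 1) * (((n + 1 : ℝ) ^ (-r) : ℝ) : ℂ)))
      (boseIntegral r q) := by
  have h := hasSum_mellin (ι := ℕ) (a := fun n => q ^ (n + 1)) (p := fun n => (n : ℝ) + 1)
    (F := fun t => q * (rexp (-t) : ℂ) / (1 - q * (rexp (-t) : ℂ))) (s := (r : ℂ))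
    (fun n => Or.inr (by positivity)) (by simpa using by linarith) ?_ ?_
  · have e : mellin (fun t : ℝ => q * (rexp (-t) : ℂ) / (1 - q * (rexp (-t) : ℂ))) (r : ℂ)
        = boseIntegral r q := by
      unfold mellin boseIntegral
      refine setIntegral_congr_fun measurableSet_Ioi fun t ht => ?_
      have ht : 0 < t := ht
      simp only [smul_eq_mul]
      rw [Complex.ofReal_cpow ht.le]
      push_cast
      rfl
    rw [e] at h
    refine h.congr_fun fun n => ?_
    have hn : (0 : ℝ) ≤ (n : ℝ) + 1 := by positivity
    rw [Complex.Gamma_ofReal, Real.rpow_neg hn, ← Complex.ofReal_cpow hn]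
    push_cast
    rw [div_eq_mul_inv, mul_assoc]
  · intro t ht
    have ht : 0 < t := ht
    have hlt : ‖q * (rexp (-t) : ℂ)‖ < 1 := by
      rw [norm_mul, Complex.norm_real, Real.norm_of_nonneg (exp_pos _).le]
      calc ‖q‖ * rexp (-t) ≤ 1 * rexp (-t) := by gcongr
        _ < 1 := by rw [one_mul]; simpa using ht
    have h := (hasSum_geometric_of_norm_lt_one hlt).mul_left (q * (rexp (-t) : ℂ))
    rw [← div_eq_mul_inv] at h
    refine h.congr_fun fun n => ?_
    have : -((n : ℝ) + 1) * t = ((n + 1 : ℕ) : ℝ) * (-t) := by push_cast; ring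
    rw [this, Real.exp_nat_mul]
    push_cast
    ring
  · have hs : Summable fun n : ℕ => 1 / ((n : ℝ) + 1) ^ r := by
      have := (summable_nat_add_iff 1).2 (Real.summable_one_div_nat_rpow.2 hr)
      simpa using this
    refine Summable.of_nonneg_of_le (fun n => by positivity) (fun n => ?_) hs
    simp only [Complex.ofReal_re, norm_pow]
    gcongr
    exact pow_le_one₀ (norm_nonneg _) hq

/-- The slit plane is star-shaped about `1`, so the segment from `1` to `1 - q` misses `0`. Half its
distance to `0` leaves room to move `q`; this bound dominates the differentiated integrand. -/
theorem exists_le_norm_one_sub_mul {q : ℂ} (hq : 1 - q ∈ Complex.slitPlane) :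
    ∃ δ > 0, ∀ q' ∈ Metric.ball q δ, ∀ s ∈ Set.Icc (0 : ℝ) 1, δ ≤ ‖1 - q' * (s : ℂ)‖ := by
  obtain ⟨s₀, hs₀, hmin⟩ := (isCompact_Icc (a := (0 : ℝ)) (b := 1)).exists_isMinOn
    (Set.nonempty_Icc.2 zero_le_one) (f := fun s : ℝ => ‖1 - q * (s : ℂ)‖) (by fun_prop)
  have hpos : 0 < ‖1 - q * (s₀ : ℂ)‖ := by
    rw [norm_pos_iff]
    have h := Complex.starConvex_one_slitPlane hq (a := 1 - s₀) (b := s₀)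
      (by linarith [hs₀.2]) hs₀.1 (by ring)
    have e : (1 - s₀) • (1 : ℂ) + s₀ • (1 - q) = 1 - q * s₀ := by
      simp only [Complex.real_smul]; push_cast; ring
    rw [e] at h
    exact Complex.slitPlane_ne_zero h
  refine ⟨‖1 - q * (s₀ : ℂ)‖ / 2, by positivity, fun q' hq' s hs => ?_⟩
  have h1 : ‖1 - q * (s₀ : ℂ)‖ ≤ ‖1 - q * (s : ℂ)‖ := hmin hs
  have h2 : ‖1 - q * (s : ℂ)‖ ≤ ‖1 - q' * (s : ℂ)‖ + ‖(q' - q) * (s : ℂ)‖ := by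
    have : 1 - q * (s : ℂ) = (1 - q' * (s : ℂ)) + (q' - q) * (s : ℂ) := by ring
    rw [this]; exact norm_add_le _ _
  have h3 : ‖(q' - q) * (s : ℂ)‖ ≤ ‖1 - q * (s₀ : ℂ)‖ / 2 := by
    rw [norm_mul, Complex.norm_real, Real.norm_of_nonneg hs.1]
    rw [Metric.mem_ball, dist_eq_norm] at hq'
    nlinarith [norm_nonneg (q' - q), hs.2, hs.1]
  linarith

theorem exp_neg_mem_Icc {t : ℝ} (ht : 0 < t) : rexp (-t) ∈ Set.Icc (0 : ℝ) 1 :=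
  ⟨(exp_pos _).le, Real.exp_le_one_iff.2 (by linarith)⟩

theorem hasDerivAt_boseIntegral {r : ℝ} (hr : 1 < r) {q : ℂ} (hq : 1 - q ∈ Complex.slitPlane) :
    HasDerivAt (boseIntegral r) (boseIntegralDeriv r q) q := by
  obtain ⟨δ, hδ, hb⟩ := exists_le_norm_one_sub_mul hq
  have hG := Real.GammaIntegral_convergent (s := r) (by linarith)
  have hball := Metric.ball_mem_nhds q hδ
  have hmeas (q' : ℂ) : AEStronglyMeasurable (fun t : ℝ => ((t ^ (r - 1) : ℝ) : ℂ) *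
      (q' * (rexp (-t) : ℂ) / (1 - q' * (rexp (-t) : ℂ)))) (volume.restrict (Set.Ioi 0)) := by
    apply Measurable.aestronglyMeasurable
    fun_prop
  have hbd : ∀ t > 0, ∀ q' ∈ Metric.ball q δ, ‖((t ^ (r - 1) : ℝ) : ℂ) *
      ((rexp (-t) : ℂ) / (1 - q' * (rexp (-t) : ℂ)) ^ 2)‖ ≤
      (rexp (-t) * t ^ (r - 1)) * (1 / δ ^ 2) := by
    intro t ht q' hq'
    have h := hb q' hq' _ (exp_neg_mem_Icc ht)
    rw [norm_mul, norm_div, norm_pow, Complex.norm_real, Complex.norm_real,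
      Real.norm_of_nonneg (exp_pos _).le, Real.norm_of_nonneg (by positivity)]
    calc t ^ (r - 1) * (rexp (-t) / ‖1 - q' * (rexp (-t) : ℂ)‖ ^ 2)
        ≤ t ^ (r - 1) * (rexp (-t) / δ ^ 2) := by gcongr
      _ = _ := by ring
  refine (hasDerivAt_integral_of_dominated_loc_of_deriv_le hball
    (Filter.Eventually.of_forall hmeas) ?_ (F' := fun q' t => ((t ^ (r - 1) : ℝ) : ℂ) *
      ((rexp (-t) : ℂ) / (1 - q' * (rexp (-t) : ℂ)) ^ 2))
    (bound := fun t => (rexp (-t) * t ^ (r - 1)) * (1 / δ ^ 2)) ?_ ?_ (hG.mul_const _) ?_).2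
  · refine Integrable.mono' (hG.mul_const (‖q‖ / δ)) (hmeas q) ?_
    filter_upwards [ae_restrict_mem measurableSet_Ioi] with t ht
    have ht : 0 < t := ht
    have h := hb q (Metric.mem_ball_self hδ) _ (exp_neg_mem_Icc ht)
    rw [norm_mul, norm_div, norm_mul, Complex.norm_real, Complex.norm_real,
      Real.norm_of_nonneg (exp_pos _).le, Real.norm_of_nonneg (by positivity)]
    calc t ^ (r - 1) * (‖q‖ * rexp (-t) / ‖1 - q * (rexp (-t) : ℂ)‖)
        ≤ t ^ (r - 1) * (‖q‖ * rexp (-t) / δ) := by gcongr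
      _ = _ := by ring
  · apply Measurable.aestronglyMeasurable
    fun_prop
  · filter_upwards [ae_restrict_mem measurableSet_Ioi] with t ht q' hq' using hbd t ht q' hq'
  · filter_upwards [ae_restrict_mem measurableSet_Ioi] with t ht q' hq'
    have h := hb q' hq' _ (exp_neg_mem_Icc ht)
    have hne : 1 - q' * (rexp (-t) : ℂ) ≠ 0 := norm_pos_iff.1 (hδ.trans_le h)
    have h1 : HasDerivAt (fun x : ℂ => x * (rexp (-t) : ℂ)) (rexp (-t) : ℂ) q' := by
      simpa using (hasDerivAt_id q').mul_const (rexp (-t) : ℂ)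
    convert! (h1.div (h1.const_sub 1) hne).const_mul ((t ^ (r - 1) : ℝ) : ℂ) using 2
    ring

theorem contDiffOn_boseIntegral {r : ℝ} (hr : 1 < r) {n : WithTop ℕ∞} :
    ContDiffOn ℂ n (boseIntegral r) {q | 1 - q ∈ Complex.slitPlane} := by
  refine DifferentiableOn.contDiffOn
    (fun q hq => (hasDerivAt_boseIntegral hr hq).differentiableAt.differentiableWithinAt) ?_
  exact Complex.isOpen_slitPlane.preimage (by fun_prop)

/-- After rotation by `e^{-ix}` the real number `s` no longer affects the imaginary part. -/
theorem norm_one_sub_expI_mul_ge (x s : ℝ) :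
    |Real.sin x| ≤ ‖1 - Complex.exp (x * Complex.I) * (s : ℂ)‖ := by
  have h : (1 - Complex.exp (x * Complex.I) * (s : ℂ))
      = Complex.exp (x * Complex.I) * (Complex.exp ((-x : ℝ) * Complex.I) - s) := by
    rw [mul_sub, ← Complex.exp_add]
    simp
  rw [h, norm_mul, Complex.norm_exp_ofReal_mul_I, one_mul]
  refine le_trans (le_of_eq ?_) (Complex.abs_im_le_norm _)
  simp [Complex.exp_ofReal_mul_I_im, -Complex.ofReal_neg]

theorem integrableOn_rpow_mul_exp_neg {a : ℝ} (ha : 0 < a) :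
    IntegrableOn (fun t : ℝ => t ^ (a - 1) * (1 + t) ^ 2 * rexp (-t)) (Set.Ioi 0) := by
  have h0 := Real.GammaIntegral_convergent (s := a) ha
  have h1 := Real.GammaIntegral_convergent (s := a + 1) (by linarith)
  have h2 := Real.GammaIntegral_convergent (s := a + 2) (by linarith)
  refine ((h0.add (h1.const_mul 2)).add h2).congr_fun (fun t ht => ?_) measurableSet_Ioi
  have ht : 0 < t := ht
  have e1 : t ^ (a + 1 - 1) = t ^ (a - 1) * t := by
    rw [show a + 1 - 1 = (a - 1) + 1 by ring, Real.rpow_add_one ht.ne']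
  have e2 : t ^ (a + 2 - 1) = t ^ (a - 1) * t ^ 2 := by
    rw [show a + 2 - 1 = (a - 1) + (2 : ℕ) by push_cast; ring, Real.rpow_add_natCast ht.ne']
  simp only [Pi.add_apply, e1, e2]
  ring

/-- Near `q = 1` on the unit circle the derivative of the Bose integral has an integrable
singularity. -/
theorem exists_norm_boseIntegralDeriv_le {r θ : ℝ} (hθ : 0 ≤ θ) (hθ' : θ ≤ 2)
    (hrθ : 2 - r < θ) : ∃ C, 0 ≤ C ∧ ∀ x : ℝ, Real.sin x ≠ 0 →
      ‖boseIntegralDeriv r (Complex.exp (x * Complex.I))‖ ≤ C * |Real.sin x| ^ (-θ) := by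
  have hI := integrableOn_rpow_mul_exp_neg (a := r + θ - 2) (by linarith)
  refine ⟨∫ t in Set.Ioi (0 : ℝ), t ^ (r + θ - 2 - 1) * (1 + t) ^ 2 * rexp (-t),
    setIntegral_nonneg measurableSet_Ioi fun t ht => ?_, fun x hx => ?_⟩
  · have ht : 0 < t := ht
    positivity
  rw [← integral_mul_const]
  refine norm_integral_le_of_norm_le (hI.mul_const _) ?_
  filter_upwards [ae_restrict_mem measurableSet_Ioi] with t ht
  have ht : 0 < t := ht
  have hsin : 0 < |Real.sin x| := abs_pos.2 hx
  rw [norm_mul, norm_div, norm_pow, Complex.norm_real, Complex.norm_real,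
    Real.norm_of_nonneg (exp_pos _).le, Real.norm_of_nonneg (by positivity)]
  set N := ‖1 - Complex.exp (x * Complex.I) * (rexp (-t) : ℂ)‖ with hN
  have hb : |Real.sin x| ≤ N := norm_one_sub_expI_mul_ge x _
  have hNpos : 0 < N := hsin.trans_le hb
  have ha : t / (1 + t) ≤ N := by
    have h1 : 1 - rexp (-t) ≤ N := by
      have := norm_sub_norm_le (1 : ℂ) (Complex.exp (x * Complex.I) * (rexp (-t) : ℂ))
      rwa [norm_one, norm_mul, Complex.norm_exp_ofReal_mul_I, one_mul, Complex.norm_real,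
        Real.norm_of_nonneg (exp_pos _).le] at this
    have h2 : rexp (-t) ≤ 1 / (1 + t) := by
      rw [Real.exp_neg, ← one_div]
      exact one_div_le_one_div_of_le (by positivity) (by linarith [Real.add_one_le_exp t])
    have h3 : t / (1 + t) = 1 - 1 / (1 + t) := by field_simp; ring
    linarith
  -- Interpolates the two lower bounds for `N`. The power of `t` left over is `r + θ - 3`,
  -- integrable at `0` exactly because `θ > 2 - r`.
  have hsq : (t / (1 + t)) ^ (2 - θ) * |Real.sin x| ^ θ ≤ N ^ 2 := by
    calc (t / (1 + t)) ^ (2 - θ) * |Real.sin x| ^ θ ≤ N ^ (2 - θ) * N ^ θ := by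
          gcongr
      _ = N ^ 2 := by
          rw [← Real.rpow_add hNpos]; norm_num
  have hlow : t ^ (2 - θ) / (1 + t) ^ 2 ≤ (t / (1 + t)) ^ (2 - θ) := by
    rw [Real.div_rpow ht.le (by positivity)]
    gcongr
    calc (1 + t) ^ (2 - θ) ≤ (1 + t) ^ (2 : ℝ) :=
          Real.rpow_le_rpow_of_exponent_le (by linarith) (by linarith)
      _ = (1 + t) ^ 2 := by norm_num
  have hfin : t ^ (2 - θ) / (1 + t) ^ 2 * |Real.sin x| ^ θ ≤ N ^ 2 :=
    le_trans (by gcongr) hsq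
  calc t ^ (r - 1) * (rexp (-t) / N ^ 2)
      ≤ t ^ (r - 1) * (rexp (-t) / (t ^ (2 - θ) / (1 + t) ^ 2 * |Real.sin x| ^ θ)) := by
        gcongr
    _ = (t ^ (r - 1) / t ^ (2 - θ)) * (1 + t) ^ 2 * rexp (-t) * |Real.sin x| ^ (-θ) := by
        rw [Real.rpow_neg hsin.le]
        field_simp
    _ = _ := by
        rw [← Real.rpow_sub ht]
        ring_nf

/-! ### The kernel of `L_r` and its derivative -/

/-- The periodic convolution kernel of the multiplier `L_r`. -/
noncomputable def multiplierKernel (r : ℝ) (x : ℝ) : ℂ :=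
  ∑' k : ℤ, (homogeneousSymbol r k : ℂ) * Complex.exp (Complex.I * (k : ℂ) * (x : ℂ))

theorem homogeneousSymbol_nonneg (r : ℝ) (k : ℤ) : 0 ≤ homogeneousSymbol r k := by
  unfold homogeneousSymbol; split_ifs <;> positivity

theorem summable_homogeneousSymbol {r : ℝ} (hr : 1 < r) : Summable (homogeneousSymbol r) := by
  refine (Real.summable_abs_int_rpow hr).congr fun k => ?_
  unfold homogeneousSymbol
  split_ifs with h
  · simp [h, Real.zero_rpow (by linarith : -r ≠ 0)]
  · rfl

theorem norm_exp_I_mul_intCast_mul (k : ℤ) (x : ℝ) :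
    ‖Complex.exp (Complex.I * (k : ℂ) * (x : ℂ))‖ = 1 := by
  rw [show Complex.I * (k : ℂ) * (x : ℂ) = ((k * x : ℝ) : ℂ) * Complex.I by push_cast; ring]
  exact Complex.norm_exp_ofReal_mul_I _

theorem norm_multiplierKernel_term (r : ℝ) (k : ℤ) (x : ℝ) :
    ‖(homogeneousSymbol r k : ℂ) * Complex.exp (Complex.I * (k : ℂ) * (x : ℂ))‖
      = homogeneousSymbol r k := by
  rw [norm_mul, norm_exp_I_mul_intCast_mul, mul_one, Complex.norm_real,
    Real.norm_of_nonneg (homogeneousSymbol_nonneg r k)]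

theorem exp_I_mul_intCast_mul_periodic (k : ℤ) :
    Function.Periodic (fun x : ℝ => Complex.exp (Complex.I * (k : ℂ) * (x : ℂ))) (2 * π) := by
  intro x
  refine (congrArg Complex.exp ?_).trans (Complex.exp_periodic.int_mul k _)
  push_cast
  ring

theorem hasSum_multiplierKernel {r : ℝ} (hr : 1 < r) (x : ℝ) :
    HasSum (fun k : ℤ => (homogeneousSymbol r k : ℂ) *
      Complex.exp (Complex.I * (k : ℂ) * (x : ℂ))) (multiplierKernel r x) :=
  (Summable.of_norm_bounded (summable_homogeneousSymbol hr)
    fun k => (norm_multiplierKernel_term r k x).le).hasSum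

theorem multiplierKernel_periodic (r : ℝ) :
    Function.Periodic (multiplierKernel r) (2 * π) := by
  intro x
  unfold multiplierKernel
  exact tsum_congr fun k => by
    congr 1
    exact exp_I_mul_intCast_mul_periodic k x

theorem continuous_multiplierKernel {r : ℝ} (hr : 1 < r) : Continuous (multiplierKernel r) :=
  continuous_tsum (fun k => by fun_prop) (summable_homogeneousSymbol hr)
    fun k x => (norm_multiplierKernel_term r k x).le

theorem Gamma_mul_multiplierKernel {r : ℝ} (hr : 1 < r) (x : ℝ) :
    (Real.Gamma r : ℂ) * multiplierKernel r x =
      boseIntegral r (Complex.exp (x * Complex.I))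
        + boseIntegral r (Complex.exp ((-x : ℝ) * Complex.I)) := by
  have hK := (hasSum_multiplierKernel hr x).mul_left (Real.Gamma r : ℂ)
  have h1 := hasSum_boseIntegral hr (Complex.norm_exp_ofReal_mul_I x).le
  have h2 := hasSum_boseIntegral hr (Complex.norm_exp_ofReal_mul_I (-x)).le
  refine hK.unique (HasSum.of_nat_of_neg_add_one ?_ ?_)
  -- The mode `k = 0` has symbol zero; dropping it aligns the indices with the Bose series.
  · rw [← hasSum_nat_add_iff' 1]
    simp only [Finset.range_one, Finset.sum_singleton]
    have e : (homogeneousSymbol r ((0 : ℕ) : ℤ)) = 0 := by simp [homogeneousSymbol]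
    rw [e]
    simp only [Complex.ofReal_zero, zero_mul, mul_zero, sub_zero]
    refine h1.congr_fun fun n => ?_
    have hs : homogeneousSymbol r ((n + 1 : ℕ) : ℤ) = ((n : ℝ) + 1) ^ (-r) := by
      unfold homogeneousSymbol
      rw [if_neg (by omega)]
      push_cast
      rw [abs_of_nonneg (by positivity)]
    rw [hs, ← Complex.exp_nat_mul, mul_comm (Complex.exp _)]
    congr 3
    push_cast
    ring
  · refine h2.congr_fun fun n => ?_
    have hs : homogeneousSymbol r (-((n : ℤ) + 1)) = ((n : ℝ) + 1) ^ (-r) := by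
      unfold homogeneousSymbol
      rw [if_neg (by omega)]
      push_cast
      rw [abs_neg, abs_of_nonneg (by positivity)]
    rw [hs, ← Complex.exp_nat_mul, mul_comm (Complex.exp _)]
    congr 3
    push_cast
    ring

theorem multiplierKernel_eq {r : ℝ} (hr : 1 < r) :
    multiplierKernel r = fun x : ℝ => (Real.Gamma r : ℂ)⁻¹ *
      (boseIntegral r (Complex.exp (x * Complex.I))
        + boseIntegral r (Complex.exp ((-x : ℝ) * Complex.I))) := by
  have hΓ : (Real.Gamma r : ℂ) ≠ 0 := by
    exact_mod_cast (Real.Gamma_pos_of_pos (by linarith : 0 < r)).ne'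
  funext x
  rw [← Gamma_mul_multiplierKernel hr x, inv_mul_cancel_left₀ hΓ]

theorem one_sub_expI_mem_slitPlane {x : ℝ} (hx : Real.cos x ≠ 1) :
    1 - Complex.exp (x * Complex.I) ∈ Complex.slitPlane := by
  left
  rw [Complex.sub_re, Complex.exp_ofReal_mul_I_re, Complex.one_re]
  have := lt_of_le_of_ne (Real.cos_le_one x) hx
  linarith

theorem contDiffAt_multiplierKernel {r : ℝ} (hr : 1 < r) {n : WithTop ℕ∞} {x : ℝ}
    (hx : Real.cos x ≠ 1) : ContDiffAt ℝ n (multiplierKernel r) x := by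
  have hB {y : ℝ} (hy : Real.cos y ≠ 1) :
      ContDiffAt ℝ n (boseIntegral r) (Complex.exp (y * Complex.I)) :=
    ((contDiffOn_boseIntegral hr).contDiffAt
      ((Complex.isOpen_slitPlane.preimage (by fun_prop : Continuous fun q : ℂ => 1 - q)).mem_nhds
        (one_sub_expI_mem_slitPlane hy))).restrict_scalars ℝ
  have hE : ContDiff ℝ n fun y : ℝ => Complex.exp (y * Complex.I) :=
    ContDiff.cexp (Complex.ofRealCLM.contDiff.mul contDiff_const)
  rw [multiplierKernel_eq hr]
  refine contDiffAt_const.mul (ContDiffAt.add ?_ ?_)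
  · exact ContDiffAt.comp (g := boseIntegral r) x (hB hx) hE.contDiffAt
  · exact ContDiffAt.comp (g := boseIntegral r) x (hB (y := -x) (by rwa [Real.cos_neg]))
      (hE.comp contDiff_neg).contDiffAt

theorem exists_norm_deriv_multiplierKernel_le {r : ℝ} (hr : 1 < r) :
    ∃ C θ : ℝ, 0 ≤ C ∧ 0 ≤ θ ∧ θ < 1 ∧ ∀ x, Real.sin x ≠ 0 →
      ‖deriv (multiplierKernel r) x‖ ≤ C * |Real.sin x| ^ (-θ) := by
  -- `(3 - r) / 2` is the midpoint of `2 - r` and `1`; the maximum with `1 / 2` keeps `θ` positive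
  -- for large `r`.
  set θ : ℝ := max (1 / 2) ((3 - r) / 2) with hθ
  have hθ0 : 1 / 2 ≤ θ := le_max_left _ _
  have hθ1 : θ < 1 := max_lt (by norm_num) (by linarith)
  have hθr : 2 - r < θ := lt_of_lt_of_le (by linarith) (le_max_right _ _)
  obtain ⟨C, hC, hb⟩ := exists_norm_boseIntegralDeriv_le (r := r) (by linarith : 0 ≤ θ)
    (by linarith) hθr
  refine ⟨‖(Real.Gamma r : ℂ)⁻¹‖ * (C + C), θ, by positivity, by linarith, hθ1, fun x hx => ?_⟩
  have hcos : Real.cos x ≠ 1 := fun h => hx (by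
    have := Real.sin_sq_add_cos_sq x
    rw [h] at this
    nlinarith)
  have hE (y : ℝ) : HasDerivAt (fun y : ℝ => Complex.exp (y * Complex.I))
      (Complex.exp (y * Complex.I) * Complex.I) y := by
    have h : HasDerivAt (fun y : ℝ => (y : ℂ) * Complex.I) Complex.I y := by
      simpa using (Complex.ofRealCLM.hasDerivAt (x := y)).mul_const Complex.I
    exact h.cexp
  have h1 := (hasDerivAt_boseIntegral hr (one_sub_expI_mem_slitPlane hcos)).comp x (hE x)
  have h2 := (hasDerivAt_boseIntegral hr (one_sub_expI_mem_slitPlane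
    (x := -x) (by rwa [Real.cos_neg]))).comp (-x) (hE (-x))
  have h3 := h2.scomp x (hasDerivAt_neg x)
  have hd := (h1.add h3).const_mul (Real.Gamma r : ℂ)⁻¹
  rw [multiplierKernel_eq hr]
  refine (congrArg norm hd.deriv).trans_le ?_
  rw [norm_mul, mul_assoc]
  gcongr
  have n1 := hb x hx
  have n2 := hb (-x) (by simpa using hx)
  rw [Real.sin_neg, abs_neg] at n2
  refine (norm_add_le _ _).trans ?_
  rw [add_mul]
  gcongr
  · simpa [Complex.norm_exp_ofReal_mul_I] using n1
  · rw [norm_smul, norm_mul, norm_mul, Complex.norm_exp_ofReal_mul_I]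
    simpa using n2

/-! ### Local convolution and a periodic cutoff -/

/-- For `x` near `x₀` the integral only sees `g` on a ball slightly larger than `R`, so `g` may be
multiplied by a bump equal to `1` there, and smoothness of convolution with a compactly supported
function applies. -/
theorem contDiffAt_integral_mul_sub {f g : ℝ → ℂ} {R R' x₀ : ℝ} (hf : Integrable f)
    (hsupp : ∀ s, R < |s| → f s = 0) (hR : 0 ≤ R) (hRR' : R < R') {n : ℕ∞}
    (hg : ContDiffOn ℝ n g (Metric.ball x₀ R')) :
    ContDiffAt ℝ n (fun x => ∫ s, f s * g (x - s)) x₀ := by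
  set d := (R' - R) / 3 with hd
  have hd0 : 0 < d := by rw [hd]; linarith
  let χ : ContDiffBump x₀ := ⟨R + d, R + 2 * d, by linarith, by linarith⟩
  have hsub : tsupport (fun x => (χ x : ℂ) * g x) ⊆ Metric.closedBall x₀ (R + 2 * d) := by
    rw [← χ.tsupport_eq]
    refine closure_mono fun x hx => ?_
    rw [Function.mem_support] at hx ⊢
    intro h
    exact hx (by simp [h])
  have hG : ContDiff ℝ n fun x => (χ x : ℂ) * g x := by
    refine contDiff_iff_contDiffAt.2 fun x => ?_
    by_cases hx : x ∈ tsupport fun x => (χ x : ℂ) * g x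
    swap
    · exact contDiffAt_const.congr_of_eventuallyEq (notMem_tsupport_iff_eventuallyEq.1 hx)
    have hx' : x ∈ Metric.ball x₀ R' :=
      Metric.closedBall_subset_ball (by rw [hd]; linarith) (hsub hx)
    exact (Complex.ofRealCLM.contDiff.contDiffAt.comp x χ.contDiff.contDiffAt).mul
      (hg.contDiffAt (Metric.isOpen_ball.mem_nhds hx'))
  have hc : HasCompactSupport fun x => (χ x : ℂ) * g x :=
    (isCompact_closedBall x₀ (R + 2 * d)).of_isClosed_subset (isClosed_tsupport _) hsub
  have hconv := hc.contDiff_convolution_right (ContinuousLinearMap.mul ℝ ℂ)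
    (hf.locallyIntegrable (μ := volume)) hG
  refine hconv.contDiffAt.congr_of_eventuallyEq ?_
  filter_upwards [Metric.ball_mem_nhds x₀ hd0] with x hx
  refine integral_congr_ae (Filter.Eventually.of_forall fun s => ?_)
  simp only [ContinuousLinearMap.mul_apply']
  by_cases hs : R < |s|
  · simp [hsupp s hs]
  · have hmem : x - s ∈ Metric.closedBall x₀ (R + d) := by
      rw [Metric.mem_ball, Real.dist_eq] at hx
      rw [Metric.mem_closedBall, Real.dist_eq]
      calc |x - s - x₀| = |(x - x₀) - s| := by ring_nf
        _ ≤ |x - x₀| + |s| := abs_sub _ _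
        _ ≤ R + d := by linarith
    rw [χ.one_of_mem_closedBall hmem]
    simp

theorem Function.Periodic.integral_mul_sub_comm {f g : ℝ → ℂ}
    (hf : Function.Periodic f (2 * π)) (hg : Function.Periodic g (2 * π)) (x : ℝ) :
    ∫ s in (-π)..π, f s * g (x - s) = ∫ s in (-π)..π, g s * f (x - s) := by
  have h1 := intervalIntegral.integral_comp_sub_left (a := -π) (b := π)
    (fun s => g s * f (x - s)) x
  have hp : Function.Periodic (fun s => g s * f (x - s)) (2 * π) := fun s => by
    have : x - (s + 2 * π) = (x - s) - 2 * π := by ring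
    simp only [this, hg s, hf.sub_eq]
  have h2 := hp.intervalIntegral_add_eq (x - π) (-π)
  rw [show x - π + 2 * π = x - -π by ring, show -π + 2 * π = π by ring] at h2
  rw [← h2, ← h1]
  refine intervalIntegral.integral_congr fun s _ => ?_
  simp only [sub_sub_cancel, mul_comm]

theorem exists_periodic_cutoff {ε : ℝ} (hε : 0 < ε) (hε1 : ε ≤ π) :
    ∃ η : ℝ → ℝ, ContDiff ℝ ∞ η ∧ Function.Periodic η (2 * π) ∧
      (∀ s, Real.cos s ≤ Real.cos ε → η s = 0) ∧
      ∀ s, Real.cos s = 1 → η =ᶠ[nhds s] 1 := by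
  have hc : Real.cos ε < 1 := by
    have := Real.cos_lt_cos_of_nonneg_of_le_pi le_rfl hε1 hε
    rwa [Real.cos_zero] at this
  -- A function of `cos s` is automatically periodic. The scaling makes the argument reach `1` at
  -- the midpoint of `cos ε` and `1`.
  refine ⟨fun s => Real.smoothTransition ((Real.cos s - Real.cos ε) * (2 / (1 - Real.cos ε))),
    ?_, ?_, ?_, ?_⟩
  · exact Real.smoothTransition.contDiff.comp
      ((Real.contDiff_cos.sub contDiff_const).mul contDiff_const)
  · intro s
    simp only [Real.cos_periodic s]
  · intro s hs
    refine Real.smoothTransition.zero_of_nonpos (mul_nonpos_of_nonpos_of_nonneg (by linarith) ?_)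
    have : 0 < 1 - Real.cos ε := by linarith
    positivity
  · intro s hs
    have hev : ∀ᶠ y in nhds s, (1 + Real.cos ε) / 2 < Real.cos y :=
      Real.continuous_cos.continuousAt.eventually (lt_mem_nhds (by rw [hs]; linarith))
    filter_upwards [hev] with y hy
    refine Real.smoothTransition.one_of_one_le ?_
    have : 0 < 1 - Real.cos ε := by linarith
    rw [mul_div_assoc', le_div_iff₀ this]
    linarith

theorem intervalIntegrable_abs_rpow {p : ℝ} (hp : -1 < p) (a b : ℝ) :
    IntervalIntegrable (fun x : ℝ => |x| ^ p) volume a b := by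
  refine intervalIntegrable_of_even (fun x => by rw [abs_neg]) (fun x hx => ?_)
  refine (intervalIntegral.intervalIntegrable_rpow' hp (a := 0) (b := x)).congr ?_
  intro y hy
  rw [Set.uIoc_of_le hx.le] at hy
  simp only [abs_of_pos hy.1]

theorem cos_ne_one_of_abs_le_pi {s : ℝ} (hs : s ≠ 0) (hs' : |s| ≤ π) : Real.cos s ≠ 1 := by
  rw [← Real.cos_abs, ← Real.cos_zero]
  exact (Real.cos_lt_cos_of_nonneg_of_le_pi le_rfl hs' (abs_pos.2 hs)).ne

/-! ### The truncated kernel -/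

section Truncation

variable {r ε : ℝ} {η : ℝ → ℝ}

theorem contDiffAt_cutoff_mul_kernel (hr : 1 < r) (hη : ContDiff ℝ ∞ η) {s : ℝ}
    (hs : Real.cos s ≠ 1) :
    ContDiffAt ℝ ∞ (fun s => (η s : ℂ) * multiplierKernel r s) s :=
  (Complex.ofRealCLM.contDiff.contDiffAt.comp s hη.contDiffAt).mul
    (contDiffAt_multiplierKernel hr hs)

theorem deriv_cutoff_mul_kernel_eq_zero (hε : 0 < ε)
    (hη0 : ∀ s, Real.cos s ≤ Real.cos ε → η s = 0) {s : ℝ} (hs : ε < |s|) (hs' : |s| ≤ π) :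
    deriv (fun s => (η s : ℂ) * multiplierKernel r s) s = 0 := by
  have hc : Real.cos s < Real.cos ε := by
    rw [← Real.cos_abs s]
    exact Real.cos_lt_cos_of_nonneg_of_le_pi hε.le hs' hs
  have hev : (fun s => (η s : ℂ) * multiplierKernel r s) =ᶠ[nhds s] fun _ => 0 := by
    filter_upwards [Real.continuous_cos.continuousAt.eventually (gt_mem_nhds hc)] with y hy
    simp [hη0 y hy.le]
  rw [hev.deriv_eq]
  simp

/-- In `η'K + ηK'` the first term is bounded and the second is `O(|s|^{-θ})` by Jordan's inequality.
The zeros of `sin` at `±π` do no harm, since the cutoff vanishes there. -/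
theorem intervalIntegrable_deriv_cutoff_mul_kernel (hr : 1 < r) (hε : 0 < ε) (hε1 : ε ≤ 1)
    (hη : ContDiff ℝ ∞ η) (hη0 : ∀ s, Real.cos s ≤ Real.cos ε → η s = 0) :
    IntervalIntegrable (deriv fun s => (η s : ℂ) * multiplierKernel r s) volume (-π) π := by
  obtain ⟨C, θ, hC, hθ, hθ1, hb⟩ := exists_norm_deriv_multiplierKernel_le hr
  have hη' : Continuous (deriv η) := hη.continuous_deriv (by simp)
  obtain ⟨M, hM⟩ := (isCompact_Icc (a := (-1 : ℝ)) (b := 1)).exists_bound_of_continuousOn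
    (f := fun s => ((deriv η s : ℝ) : ℂ) * multiplierKernel r s)
    ((Complex.continuous_ofReal.comp hη').mul (continuous_multiplierKernel hr)).continuousOn
  obtain ⟨N, hN⟩ := (isCompact_Icc (a := (-1 : ℝ)) (b := 1)).exists_bound_of_continuousOn
    (f := fun s => (η s : ℂ)) (Complex.continuous_ofReal.comp hη.continuous).continuousOn
  have hM0 : 0 ≤ M := (norm_nonneg _).trans (hM 0 (by norm_num))
  have hN0 : 0 ≤ N := (norm_nonneg _).trans (hN 0 (by norm_num))
  have hdom : IntervalIntegrable (fun s : ℝ => M + N * (C * ((2 / π) ^ (-θ) * |s| ^ (-θ))))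
      volume (-π) π :=
    intervalIntegrable_const.add
      ((((intervalIntegrable_abs_rpow (by linarith) _ _).const_mul _).const_mul _).const_mul _)
  refine hdom.mono_fun (measurable_deriv _).aestronglyMeasurable ?_
  have h0 : ∀ᵐ s : ℝ, s ≠ 0 := by simp [ae_iff]
  filter_upwards [ae_restrict_mem measurableSet_uIoc, ae_restrict_of_ae h0] with s hs hs0
  rw [Set.uIoc_of_le (by linarith [pi_pos])] at hs
  have hsπ : |s| ≤ π := abs_le.2 ⟨hs.1.le, hs.2⟩
  refine le_trans ?_ (le_abs_self _)
  by_cases hsε : ε < |s|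
  · rw [deriv_cutoff_mul_kernel_eq_zero hε hη0 hsε hsπ, norm_zero]
    positivity
  · have hs1 : |s| ≤ 1 := by linarith
    have hsin : 2 / π * |s| ≤ |Real.sin s| :=
      Real.mul_abs_le_abs_sin (by linarith [Real.pi_gt_three])
    have hpos : 0 < 2 / π * |s| := by have := abs_pos.2 hs0; positivity
    have hd1 : HasDerivAt (fun s => (η s : ℂ)) ((deriv η s : ℝ) : ℂ) s :=
      ((hη.differentiable (by simp)) s).hasDerivAt.ofReal_comp
    have hd2 : HasDerivAt (multiplierKernel r) (deriv (multiplierKernel r) s) s :=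
      ((contDiffAt_multiplierKernel hr (n := 1)
        (cos_ne_one_of_abs_le_pi hs0 hsπ)).differentiableAt (by simp)).hasDerivAt
    have hd := (hd1.mul hd2).deriv
    refine (congrArg norm hd).trans_le ((norm_add_le _ _).trans ?_)
    refine add_le_add (hM s (abs_le.1 hs1)) ?_
    rw [norm_mul]
    have hK := hb s (abs_pos.1 (hpos.trans_le hsin))
    have hpow : |Real.sin s| ^ (-θ) ≤ (2 / π * |s|) ^ (-θ) :=
      Real.rpow_le_rpow_of_nonpos hpos hsin (by linarith)
    rw [Real.mul_rpow (by positivity) (by positivity)] at hpow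
    have hNs := hN s (abs_le.1 hs1)
    exact mul_le_mul hNs (hK.trans (by gcongr)) (norm_nonneg _) hN0

/-- Integration by parts: `K` is continuous at `0` and smooth elsewhere on the period, so `0` is an
admissible exceptional point, and `η(±π) = 0` removes the boundary terms. -/
theorem integral_cutoff_mul_kernel_mul (hr : 1 < r) (hε : 0 < ε) (hε1 : ε ≤ 1)
    (hη : ContDiff ℝ ∞ η) (hη0 : ∀ s, Real.cos s ≤ Real.cos ε → η s = 0)
    {ψ Ψ : ℝ → ℂ} (hψ : Continuous ψ) (hΨ : ∀ x, HasDerivAt Ψ (ψ x) x) (x : ℝ) :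
    ∫ s in (-π)..π, (η s : ℂ) * multiplierKernel r s * ψ (x - s) =
      ∫ s in (-π)..π, deriv (fun s => (η s : ℂ) * multiplierKernel r s) s * Ψ (x - s) := by
  have hΨc : Continuous Ψ := continuous_iff_continuousAt.2 fun x => (hΨ x).continuousAt
  have hkc : Continuous fun s => (η s : ℂ) * multiplierKernel r s :=
    (Complex.continuous_ofReal.comp hη.continuous).mul (continuous_multiplierKernel hr)
  have hε' : Real.cos π ≤ Real.cos ε := by rw [Real.cos_pi]; exact Real.neg_one_le_cos ε
  have hi1 : IntervalIntegrable
      (fun s => deriv (fun s => (η s : ℂ) * multiplierKernel r s) s * Ψ (x - s)) volume (-π) π :=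
    (intervalIntegrable_deriv_cutoff_mul_kernel hr hε hε1 hη hη0).mul_continuousOn (by fun_prop)
  have hi2 : IntervalIntegrable
      (fun s => (η s : ℂ) * multiplierKernel r s * ψ (x - s)) volume (-π) π :=
    Continuous.intervalIntegrable (by fun_prop) _ _
  have h := integral_eq_of_hasDerivAt_off_countable (a := -π) (b := π) (s := {0})
    (fun s => (η s : ℂ) * multiplierKernel r s * Ψ (x - s))
    (fun s => deriv (fun s => (η s : ℂ) * multiplierKernel r s) s * Ψ (x - s)
      - (η s : ℂ) * multiplierKernel r s * ψ (x - s))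
    (Set.countable_singleton _) (by fun_prop) ?_ (hi1.sub hi2)
  · rw [intervalIntegral.integral_sub hi1 hi2, hη0 π hε', hη0 (-π) (by rwa [Real.cos_neg])] at h
    simp only [Complex.ofReal_zero, zero_mul, sub_zero] at h
    exact (sub_eq_zero.1 h).symm
  · rintro s ⟨hs, hs0⟩
    rw [min_eq_left (by linarith [pi_pos]), max_eq_right (by linarith [pi_pos])] at hs
    have hd := ((contDiffAt_cutoff_mul_kernel hr hη (cos_ne_one_of_abs_le_pi (s := s) hs0
      (abs_le.2 ⟨hs.1.le, hs.2.le⟩))).differentiableAt (by simp)).hasDerivAt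
    have hd2 : HasDerivAt (fun s => Ψ (x - s)) (-ψ (x - s)) s := HasDerivAt.comp_const_sub x s (hΨ (x - s))
    convert! hd.mul hd2 using 1
    ring

end Truncation

/-! ### Local gain of one derivative -/

/-- Convolution with the kernel of `L_r`, `r > 1`, gains one derivative locally. -/
theorem contDiffOn_kernel_integral {r : ℝ} (hr : 1 < r) {ψ : ℝ → ℂ} (hψ : Continuous ψ)
    (hper : Function.Periodic ψ (2 * π)) {U : Set ℝ} (hU : IsOpen U) {n : ℕ}
    (h : ContDiffOn ℝ n ψ U) :
    ContDiffOn ℝ ((n + 1 : ℕ) : ℕ∞)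
      (fun x => ∫ s in (-π)..π, multiplierKernel r s * ψ (x - s)) U := by
  intro x₀ hx₀
  refine ContDiffAt.contDiffWithinAt ?_
  obtain ⟨δ, hδ, hball⟩ := Metric.isOpen_iff.1 hU x₀ hx₀
  set ε := min (δ / 2) 1 with hεdef
  have hε : 0 < ε := lt_min (by linarith) one_pos
  have hε1 : ε ≤ 1 := min_le_right _ _
  have hεδ : ε < δ := (min_le_left _ _).trans_lt (by linarith)
  have hεπ : ε < π := by linarith [Real.pi_gt_three]
  obtain ⟨η, hη, hηper, hη0, hη1⟩ := exists_periodic_cutoff hε hεπ.le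
  have hηc := hη.continuous
  have hKc := continuous_multiplierKernel hr
  -- `Ψ` need not be periodic; it is only used against a kernel supported within one period.
  set Ψ : ℝ → ℂ := fun x => ∫ y in (0 : ℝ)..x, ψ y with hΨdef
  have hΨ : ∀ x, HasDerivAt Ψ (ψ x) x := fun x =>
    (hψ.integral_hasStrictDerivAt 0 x).hasDerivAt
  have hΨs : ContDiffOn ℝ ((n + 1 : ℕ) : ℕ∞) Ψ (Metric.ball x₀ δ) := by
    refine ContDiffOn.mono ?_ hball
    have : ContDiffOn ℝ ((n : WithTop ℕ∞) + 1) Ψ U := by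
      rw [contDiffOn_succ_iff_deriv_of_isOpen hU]
      refine ⟨fun x _ => (hΨ x).differentiableAt.differentiableWithinAt, by simp, ?_⟩
      rwa [show deriv Ψ = ψ from funext fun x => (hΨ x).deriv]
    exact_mod_cast this
  have hnear : ContDiffAt ℝ ((n + 1 : ℕ) : ℕ∞) (fun x => ∫ s, (Set.Ioc (-π) π).indicator
      (deriv fun s => (η s : ℂ) * multiplierKernel r s) s * Ψ (x - s)) x₀ := by
    refine contDiffAt_integral_mul_sub (R := ε) ?_ (fun s hs => ?_) hε.le hεδ hΨs
    · rw [integrable_indicator_iff measurableSet_Ioc]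
      exact (intervalIntegrable_iff_integrableOn_Ioc_of_le (by linarith [pi_pos])).1
        (intervalIntegrable_deriv_cutoff_mul_kernel hr hε hε1 hη hη0)
    · refine Set.indicator_apply_eq_zero.2 fun hmem => ?_
      exact deriv_cutoff_mul_kernel_eq_zero hε hη0 hs (abs_le.2 ⟨hmem.1.le, hmem.2⟩)
  have hfarK : ContDiff ℝ ∞ fun s => (1 - (η s : ℂ)) * multiplierKernel r s := by
    refine contDiff_iff_contDiffAt.2 fun s => ?_
    by_cases hs : Real.cos s = 1
    · refine (contDiffAt_const (c := (0 : ℂ))).congr_of_eventuallyEq ?_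
      filter_upwards [hη1 s hs] with y hy
      simp [hy]
    · exact (contDiffAt_const.sub
        (Complex.ofRealCLM.contDiff.contDiffAt.comp s hη.contDiffAt)).mul
        (contDiffAt_multiplierKernel hr hs)
  have hfar : ContDiffAt ℝ ((n + 1 : ℕ) : ℕ∞) (fun x => ∫ s, (Set.Ioc (-π) π).indicator ψ s *
      ((1 - (η (x - s) : ℂ)) * multiplierKernel r (x - s))) x₀ := by
    refine contDiffAt_integral_mul_sub (R := π) (R' := π + 1) ?_ (fun s hs => ?_) pi_pos.le
      (by linarith) (g := fun s => (1 - (η s : ℂ)) * multiplierKernel r s)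
      (hfarK.of_le (by exact_mod_cast le_top)).contDiffOn
    · rw [integrable_indicator_iff measurableSet_Ioc]
      exact (intervalIntegrable_iff_integrableOn_Ioc_of_le (by linarith [pi_pos])).1
        (hψ.intervalIntegrable _ _)
    · refine Set.indicator_of_notMem (fun hmem => ?_) _
      exact absurd (abs_le.2 ⟨hmem.1.le, hmem.2⟩) (not_le.2 hs)
  refine (hnear.add hfar).congr_of_eventuallyEq (Filter.Eventually.of_forall fun x => ?_)
  have hind (f g : ℝ → ℂ) : ∫ s, (Set.Ioc (-π) π).indicator f s * g s
      = ∫ s in (-π)..π, f s * g s := by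
    rw [intervalIntegral.integral_of_le (by linarith [pi_pos]), ← integral_indicator
      measurableSet_Ioc]
    simp only [Set.indicator_mul_left]
  -- Moves the translation by `x` from `ψ` onto the smooth far part of the kernel.
  have hflip := Function.Periodic.integral_mul_sub_comm
    (f := fun s => (1 - (η s : ℂ)) * multiplierKernel r s) (fun s => by
      simp only [hηper s, multiplierKernel_periodic r s]) hper x
  beta_reduce
  rw [hind, hind _ (fun s => (1 - (η (x - s) : ℂ)) * multiplierKernel r (x - s)), ← hflip,
    ← integral_cutoff_mul_kernel_mul hr hε hε1 hη hη0 hψ hΨ x,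
    ← intervalIntegral.integral_add]
  · refine intervalIntegral.integral_congr fun s _ => ?_
    ring
  · exact Continuous.intervalIntegrable (by fun_prop) _ _
  · exact Continuous.intervalIntegrable (by fun_prop) _ _

/-! ### Fourier coefficients and `L_r` as a convolution -/

theorem torusFourierCoeff_eq (f : ℝ → ℝ) (k : ℤ) :
    torusFourierCoeff f k =
      ((1 / (2 * π) : ℝ) : ℂ) * ∫ y in (-π)..π, Complex.exp (-(Complex.I * k * y)) * (f y : ℂ) := by
  unfold torusFourierCoeff
  rw [fourierCoeffOn_eq_integral, Complex.real_smul, show π - -π = 2 * π by ring]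
  congr 1
  refine intervalIntegral.integral_congr fun y _ => ?_
  simp only [fourier_coe_apply, smul_eq_mul]
  congr 2
  have : (π : ℂ) ≠ 0 := by exact_mod_cast pi_ne_zero
  push_cast
  field_simp

theorem norm_torusFourierCoeff_le (f : ℝ → ℝ) (k : ℤ) :
    ‖torusFourierCoeff f k‖ ≤ 1 / (2 * π) * ∫ y in (-π)..π, ‖f y‖ := by
  have hπ : -π ≤ π := by linarith [pi_pos]
  rw [torusFourierCoeff_eq, norm_mul, Complex.norm_real, Real.norm_of_nonneg (by positivity)]
  gcongr
  refine (intervalIntegral.norm_integral_le_integral_norm hπ).trans_eq ?_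
  refine intervalIntegral.integral_congr fun y _ => ?_
  have : -(Complex.I * k * y) = Complex.I * k * ((-y : ℝ) : ℂ) := by push_cast; ring
  simp only [norm_mul, this, norm_exp_I_mul_intCast_mul, one_mul, Complex.norm_real]

theorem torusFourierCoeff_congr_ae {f g : ℝ → ℝ} (h : f =ᵐ[volume] g) (k : ℤ) :
    torusFourierCoeff f k = torusFourierCoeff g k := by
  rw [torusFourierCoeff_eq, torusFourierCoeff_eq]
  congr 1
  refine intervalIntegral.integral_congr_ae ?_
  filter_upwards [h] with y hy _
  rw [hy]

theorem continuous_fourierMultiplier {r : ℝ} (hr : 1 < r) (f : ℝ → ℝ) :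
    Continuous (fourierMultiplier r f) := by
  refine continuous_tsum (fun k => by fun_prop)
    ((summable_homogeneousSymbol hr).mul_right (1 / (2 * π) * ∫ y in (-π)..π, ‖f y‖))
    fun k x => ?_
  rw [norm_mul, norm_mul, norm_exp_I_mul_intCast_mul, mul_one, Complex.norm_real,
    Real.norm_of_nonneg (homogeneousSymbol_nonneg r k)]
  exact mul_le_mul_of_nonneg_left (norm_torusFourierCoeff_le f k) (homogeneousSymbol_nonneg r k)

theorem fourierMultiplier_periodic (r : ℝ) (f : ℝ → ℝ) :
    Function.Periodic (fourierMultiplier r f) (2 * π) := by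
  intro x
  unfold fourierMultiplier
  refine tsum_congr fun k => ?_
  congr 1
  exact exp_I_mul_intCast_mul_periodic k x

theorem fourierMultiplier_congr_ae {f g : ℝ → ℝ} (h : f =ᵐ[volume] g) (r : ℝ) :
    fourierMultiplier r f = fourierMultiplier r g := by
  funext x
  unfold fourierMultiplier
  simp only [torusFourierCoeff_congr_ae h]

/-- Absolute summability of the symbol allows summation under the integral, and `e^{ik(x-y)}`
factors. -/
theorem fourierMultiplier_eq_integral {r : ℝ} (hr : 1 < r) {f : ℝ → ℝ} (hf : Continuous f)
    (hper : Function.Periodic f (2 * π)) (x : ℝ) :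
    fourierMultiplier r f x = ((1 / (2 * π) : ℝ) : ℂ) *
      ∫ s in (-π)..π, multiplierKernel r s * (f (x - s) : ℂ) := by
  have hsum : HasSum (fun k : ℤ => ∫ y in (-π)..π, (f y : ℂ) * ((homogeneousSymbol r k : ℂ) *
      Complex.exp (Complex.I * (k : ℂ) * ((x - y : ℝ) : ℂ))))
      (∫ y in (-π)..π, (f y : ℂ) * multiplierKernel r (x - y)) := by
    refine intervalIntegral.hasSum_integral_of_dominated_convergence
      (fun k y => ‖f y‖ * homogeneousSymbol r k) (fun k => ?_) (fun k => ?_) ?_ ?_ ?_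
    · exact Continuous.aestronglyMeasurable (by fun_prop)
    · refine Filter.Eventually.of_forall fun y _ => ?_
      rw [norm_mul, norm_multiplierKernel_term, Complex.norm_real]
    · exact Filter.Eventually.of_forall fun y _ => (summable_homogeneousSymbol hr).mul_left _
    · simp only [tsum_mul_left]
      exact Continuous.intervalIntegrable (by fun_prop) _ _
    · exact Filter.Eventually.of_forall fun y _ => (hasSum_multiplierKernel hr (x - y)).mul_left _
  have hflip := Function.Periodic.integral_mul_sub_comm (multiplierKernel_periodic r)
    (g := fun y => (f y : ℂ)) (fun y => by simp only [hper y]) x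
  rw [hflip, ← hsum.tsum_eq, ← tsum_mul_left]
  unfold fourierMultiplier
  refine tsum_congr fun k => ?_
  rw [torusFourierCoeff_eq, mul_left_comm, mul_assoc, mul_assoc,
    ← intervalIntegral.integral_mul_const, ← intervalIntegral.integral_const_mul]
  congr 1
  refine intervalIntegral.integral_congr fun y _ => ?_
  have : Complex.exp (Complex.I * (k : ℂ) * ((x - y : ℝ) : ℂ)) =
      Complex.exp (-(Complex.I * k * y)) * Complex.exp (Complex.I * k * x) := by
    rw [← Complex.exp_add]
    congr 1
    push_cast
    ring
  simp only [this]
  ring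

/-- `L_r`, `r > 1`, gains one derivative locally. -/
theorem contDiffOn_fourierMultiplier {r : ℝ} (hr : 1 < r) {f : ℝ → ℝ} (hf : Continuous f)
    (hper : Function.Periodic f (2 * π)) {U : Set ℝ} (hU : IsOpen U) {n : ℕ}
    (h : ContDiffOn ℝ n f U) :
    ContDiffOn ℝ ((n + 1 : ℕ) : ℕ∞) (fourierMultiplier r f) U := by
  rw [show fourierMultiplier r f = _ from funext (fourierMultiplier_eq_integral hr hf hper)]
  exact contDiffOn_const.mul (contDiffOn_kernel_integral hr (ψ := fun x => (f x : ℂ))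
    (by fun_prop) (fun y => by simp only [hper y]) hU
    (Complex.ofRealCLM.contDiff.comp_contDiffOn h))

/-! ### Bootstrap and conclusion -/

theorem contDiffOn_of_eq_sub_sqrt {r μ c : ℝ} (hr : 1 < r) {ψ : ℝ → ℝ} (hψ : Continuous ψ)
    (hper : Function.Periodic ψ (2 * π))
    (heq : ∀ x, ψ x = μ - √(c - 2 * (fourierMultiplier r ψ x).re))
    {U : Set ℝ} (hU : IsOpen U) (hlt : ∀ x ∈ U, ψ x < μ) : ContDiffOn ℝ ∞ ψ U := by
  rw [contDiffOn_infty]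
  intro n
  induction n with
  | zero => exact contDiffOn_zero.2 hψ.continuousOn
  | succ n ih =>
    have hL := contDiffOn_fourierMultiplier hr hψ hper hU ih
    have hG : ContDiffOn ℝ ((n + 1 : ℕ) : ℕ∞)
        (fun x => c - 2 * (fourierMultiplier r ψ x).re) U :=
      contDiffOn_const.sub (contDiffOn_const.mul (Complex.reCLM.contDiff.comp_contDiffOn hL))
    rw [show ψ = _ from funext heq]
    -- Only a zero radicand must be excluded, and it would force `ψ x = μ`.
    refine contDiffOn_const.sub (hG.sqrt fun x hx h0 => ?_)
    have := hlt x hx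
    rw [heq x, h0, Real.sqrt_zero] at this
    linarith

theorem SteadyEquationAt.sq_sub_eq {r μ : ℝ} {φ : ℝ → ℝ} {x : ℝ} (h : SteadyEquationAt r μ φ x) :
    (μ - φ x) ^ 2 = μ ^ 2 + (torusFourierCoeff (fun y => φ y ^ 2) 0).re
      - 2 * (fourierMultiplier r φ x).re := by
  have h' := congrArg Complex.re h
  have e1 : (1 / 2 : ℂ) * ((μ : ℂ) - (φ x : ℂ)) ^ 2 = ((1 / 2 * (μ - φ x) ^ 2 : ℝ) : ℂ) := by
    push_cast; ring
  have e2 : (1 / 2 : ℂ) * (μ : ℂ) ^ 2 = ((1 / 2 * μ ^ 2 : ℝ) : ℂ) := by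
    push_cast; ring
  have e3 (z : ℂ) : (1 / 2 : ℂ) * z = ((1 / 2 : ℝ) : ℂ) * z := by push_cast; ring
  rw [e1, e2, e3 (torusFourierCoeff _ 0), Complex.add_re, Complex.sub_re, Complex.ofReal_re,
    Complex.ofReal_re, Complex.re_ofReal_mul] at h'
  linarith

theorem theorem4p4 (r μ : ℝ) (hr : 1 < r) (φ : ℝ → ℝ)
    (hφ : IsBoundedSteadySolution r μ φ) (hle : ∀ᵐ x, φ x ≤ μ) :
    -- the continuous representative `ψ` of the class of `φ`
    ∃ ψ : ℝ → ℝ, Continuous ψ ∧ Function.Periodic ψ (2 * π) ∧ ψ =ᵐ[volume] φ ∧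
      -- `ψ` is `φ` itself if `φ ≤ μ` and the equation hold at every point
      (∀ x, φ x ≤ μ → SteadyEquationAt r μ φ x → ψ x = φ x) ∧
      ((∃ δ > 0, ∀ᵐ x, φ x ≤ μ - δ) → ContDiff ℝ ∞ ψ) ∧
      (∀ U : Set ℝ, IsOpen U → (∀ x ∈ U, ψ x < μ) → ContDiffOn ℝ ∞ ψ U) := by
  set c : ℝ := μ ^ 2 + (torusFourierCoeff (fun y => φ y ^ 2) 0).re with hc
  let ψ : ℝ → ℝ := fun x => μ - √(c - 2 * (fourierMultiplier r φ x).re)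
  have hψc : Continuous ψ := by
    have := continuous_fourierMultiplier hr φ
    fun_prop
  have hψper : Function.Periodic ψ (2 * π) := fun x => by
    simp only [ψ, fourierMultiplier_periodic r φ x]
  have hpt : ∀ x, φ x ≤ μ → SteadyEquationAt r μ φ x → ψ x = φ x := fun x hx heq => by
    simp only [ψ]
    rw [hc, ← heq.sq_sub_eq, Real.sqrt_sq (by linarith)]
    ring
  have hae : ψ =ᵐ[volume] φ := by
    filter_upwards [hle, hφ.equation] with x hx heq using hpt x hx heq
  have hlocal : ∀ U : Set ℝ, IsOpen U → (∀ x ∈ U, ψ x < μ) → ContDiffOn ℝ ∞ ψ U :=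
    fun U hU hlt => contDiffOn_of_eq_sub_sqrt hr hψc hψper
      -- `ψ` was defined through `L_r φ`; Fourier coefficients see only the almost-everywhere class,
      -- so `ψ` solves its own fixed-point equation at every point.
      (fun x => by rw [fourierMultiplier_congr_ae hae r]) hU hlt
  refine ⟨ψ, hψc, hψper, hae, hpt, ?_, hlocal⟩
  rintro ⟨δ, hδ, hb⟩
  -- Continuous functions that agree almost everywhere are equal, so the bound `μ - δ` passes to
  -- every point of `ψ`.
  have hmin : (fun x => min (ψ x) (μ - δ)) = ψ := by
    refine ((hψc.min continuous_const).ae_eq_iff_eq volume hψc).1 ?_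
    filter_upwards [hae, hb] with x hx hxb
    rw [hx]
    exact min_eq_left hxb
  refine contDiffOn_univ.1 (hlocal Set.univ isOpen_univ fun x _ => ?_)
  have := min_eq_left_iff.1 (congrFun hmin x)
  linarith
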